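/- Let $k$ be a field and $q\in k$ with $q\neq 0,\pm1$. Let $U_q=U_q(\mathfrak{sl}_2)$ be the $k$-algebra with generators $E,F,K,K^{-1}$ and relations $KK^{-1}=K^{-1}K=1$, $KEK^{-1}=q^2E$, $KFK^{-1}=q^{-2}F$, $EF-FE=\frac{K-K^{-1}}{q-q^{-1}}$, with its Hopf algebra structure $\Delta(E)=1\otimes E+E\otimes K$, $\Delta(F)=F\otimes 1+K^{-1}\otimes F$, $\Delta(K^{\pm1})=K^{\pm1}\otimes K^{\pm1}$, $\varepsilon(E)=\varepsilon(F)=0$, $\varepsilon(K^{\pm1})=1$, $S(E)=-EK^{-1}$, $S(F)=-KF$, $S(K^{\pm1})=K^{\mp1}$. Let $w\mathfrak{sl}_q(2)$ be the $k$-algebra with generators $E_w,F_w,K_w,\overline K_w$ and relations $$K_w\overline K_w=\overline K_wK_w,\quad K_w\overline K_wK_w=K_w,\quad \overline K_wK_w\overline K_w=\overline K_w,$$ $$K_wE_w=q^2E_wK_w,\quad \overline K_wE_w=q^{-2}E_w\overline K_w,\quad K_wF_w=q^{-2}F_wK_w,\quad \overline K_wF_w=q^2F_w\overline K_w,$$ $$E_wF_w-F_wE_w=\frac{K_w-\overline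 K_w}{q-q^{-1}},$$ and put $J_w=K_w\overline K_w$. Let $\Delta_w,\varepsilon_w$ be the algebra morphisms and $T_w$ the anti-morphism of algebras given on generators by the formulas for $\Delta,\varepsilon,S$ above, with $E_w,F_w,K_w,\overline K_w$ in place of $E,F,K,K^{-1}$; $(\Delta_w,\varepsilon_w)$ makes $w\mathfrak{sl}_q(2)$ a bialgebra. Let $W\subseteq w\mathfrak{sl}_q(2)$ be the linear span of all $E_w^iF_w^jK_w^l$, $E_w^iF_w^j\overline K_w^m$, $E_w^iF_w^jJ_w$ with $i,j\ge 0$ and $l,m>0$, and let $Y$ be the linear span of all $\bigl(E_w(1-J_w)\bigr)^i\bigl(F_w(1-J_w)\bigr)^j$ with $i,j\ge0$. Then: 1. $W$ is a two-sided ideal, $Y$ is a (unital) subalgebra, and $w\mathfrak{sl}_q(2)=Y\oplus W$ as vector spaces. Also $w\mathfrak{sl}_q(2)=\operatorname{span}\{E_w^iF_w^j: i,j\ge0\}\oplus W$ as vector spaces. 2. With the multiplication of $w\mathfrak{sl}_q(2)$, the unit $J_w$, and the restrictions of $\Delta_w$, $\varepsilon_w$, $T_w$ as comultiplication, counit and antipode,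 $W$ is a Hopf algebra, and there is an isomorphism of Hopf algebras $\rho:U_q\to W$ with $\rho(E)=E_wJ_w$, $\rho(F)=F_wJ_w$, $\rho(K)=K_w$, $\rho(K^{-1})=\overline K_w$. -/

import Mathlib

open scoped TensorProduct

noncomputable section

namespace WeakQuantum

/-- Names of the four generators: `E`, `F`, `K` and `Kb`, where `Kb` stands for `K⁻¹` in
`U_q(sl_2)` and for the weak inverse `K̄_w` in `wsl_q(2)`. -/
inductive Gen : Type
  | E | F | K | Kb

section FreeGenerators

variable (k : Type*) [Field k]

/-- The generator `g` of the free algebra on the four letters. -/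
abbrev fr (g : Gen) : FreeAlgebra k Gen := FreeAlgebra.ι k g

end FreeGenerators

variable {k : Type*} [Field k]

/-- The defining relations of the weak quantum algebra `wsl_q(2)`. -/
inductive WRel (q : kˣ) : FreeAlgebra k Gen → FreeAlgebra k Gen → Prop
  | comm : WRel q (fr k .K * fr k .Kb) (fr k .Kb * fr k .K)
  | reg : WRel q (fr k .K * fr k .Kb * fr k .K) (fr k .K)
  | reg' : WRel q (fr k .Kb * fr k .K * fr k .Kb) (fr k .Kb)
  | KE : WRel q (fr k .K * fr k .E) (((q : k) ^ 2) • (fr k .E * fr k .K))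
  | KbE : WRel q (fr k .Kb * fr k .E) (((q : k) ^ 2)⁻¹ • (fr k .E * fr k .Kb))
  | KF : WRel q (fr k .K * fr k .F) (((q : k) ^ 2)⁻¹ • (fr k .F * fr k .K))
  | KbF : WRel q (fr k .Kb * fr k .F) (((q : k) ^ 2) • (fr k .F * fr k .Kb))
  | EF : WRel q (fr k .E * fr k .F - fr k .F * fr k .E)
      (((q : k) - (q : k)⁻¹)⁻¹ • (fr k .K - fr k .Kb))

/-- The defining relations of the quantum algebra `U_q(sl_2)`. -/
inductive URel (q : kˣ) : FreeAlgebra k Gen → FreeAlgebra k Gen → Prop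
  | inv : URel q (fr k .Kb * fr k .K) 1
  | inv' : URel q (fr k .K * fr k .Kb) 1
  | KE : URel q (fr k .K * fr k .E * fr k .Kb) (((q : k) ^ 2) • fr k .E)
  | KF : URel q (fr k .K * fr k .F * fr k .Kb) (((q : k) ^ 2)⁻¹ • fr k .F)
  | EF : URel q (fr k .E * fr k .F - fr k .F * fr k .E)
      (((q : k) - (q : k)⁻¹)⁻¹ • (fr k .K - fr k .Kb))

/-- The weak quantum algebra `wsl_q(2)`. -/
def WSl (q : kˣ) : Type _ := RingQuot (WRel q)

/-- The quantum algebra `U_q = U_q(sl_2)`. -/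
def USl (q : kˣ) : Type _ := RingQuot (URel q)

instance (q : kˣ) : Ring (WSl q) := inferInstanceAs (Ring (RingQuot (WRel q)))
instance (q : kˣ) : Algebra k (WSl q) := inferInstanceAs (Algebra k (RingQuot (WRel q)))
instance (q : kˣ) : Ring (USl q) := inferInstanceAs (Ring (RingQuot (URel q)))
instance (q : kˣ) : Algebra k (USl q) := inferInstanceAs (Algebra k (RingQuot (URel q)))

/-! ### The generators, the universal properties -/

namespace WSl

variable (q : kˣ)

/-- The quotient map from the free algebra. -/
def mk : FreeAlgebra k Gen →ₐ[k] WSl q := RingQuot.mkAlgHom k (WRel q)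

/-- The generator `E_w`. -/
def E : WSl q := mk q (fr k .E)
/-- The generator `F_w`. -/
def F : WSl q := mk q (fr k .F)
/-- The generator `K_w`. -/
def K : WSl q := mk q (fr k .K)
/-- The generator `K̄_w`. -/
def Kb : WSl q := mk q (fr k .Kb)
/-- The idempotent `J_w = K_w K̄_w`. -/
def J : WSl q := K q * Kb q

variable {q}

theorem mk_rel {a b : FreeAlgebra k Gen} (h : WRel q a b) : mk q a = mk q b :=
  RingQuot.mkAlgHom_rel k h

theorem comm : K q * Kb q = Kb q * K q := by
  have h := mk_rel (WRel.comm (q := q))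
  simp only [map_mul] at h
  exact h
theorem reg : K q * Kb q * K q = K q := by
  have h := mk_rel (WRel.reg (q := q))
  simp only [map_mul] at h
  exact h
theorem reg' : Kb q * K q * Kb q = Kb q := by
  have h := mk_rel (WRel.reg' (q := q))
  simp only [map_mul] at h
  exact h
theorem KE : K q * E q = ((q : k) ^ 2) • (E q * K q) := by
  have h := mk_rel (WRel.KE (q := q))
  simp only [map_mul, map_smul] at h
  exact h
theorem KbE : Kb q * E q = ((q : k) ^ 2)⁻¹ • (E q * Kb q) := by
  have h := mk_rel (WRel.KbE (q := q))
  simp only [map_mul, map_smul] at h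
  exact h
theorem KF : K q * F q = ((q : k) ^ 2)⁻¹ • (F q * K q) := by
  have h := mk_rel (WRel.KF (q := q))
  simp only [map_mul, map_smul] at h
  exact h
theorem KbF : Kb q * F q = ((q : k) ^ 2) • (F q * Kb q) := by
  have h := mk_rel (WRel.KbF (q := q))
  simp only [map_mul, map_smul] at h
  exact h
theorem EF : E q * F q - F q * E q = ((q : k) - (q : k)⁻¹)⁻¹ • (K q - Kb q) := by
  have h := mk_rel (WRel.EF (q := q))
  simp only [map_mul, map_smul, map_sub] at h
  exact h

/-- Universal property: four elements of an algebra that satisfy the defining relations define an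
algebra morphism. -/
def lift {B : Type*} [Ring B] [Algebra k B] (e f x y : B)
    (comm : x * y = y * x) (reg : x * y * x = x) (reg' : y * x * y = y)
    (xe : x * e = ((q : k) ^ 2) • (e * x)) (ye : y * e = ((q : k) ^ 2)⁻¹ • (e * y))
    (xf : x * f = ((q : k) ^ 2)⁻¹ • (f * x)) (yf : y * f = ((q : k) ^ 2) • (f * y))
    (ef : e * f - f * e = ((q : k) - (q : k)⁻¹)⁻¹ • (x - y)) : WSl q →ₐ[k] B :=
  RingQuot.liftAlgHom k ⟨FreeAlgebra.lift k (fun g => Gen.casesOn g e f x y), by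
    intro a b h
    cases h <;> simp only [map_mul, map_smul, map_sub, FreeAlgebra.lift_ι_apply] <;> assumption⟩

section lift
variable {B : Type*} [Ring B] [Algebra k B] {e f x y : B}
    {comm : x * y = y * x} {reg : x * y * x = x} {reg' : y * x * y = y}
    {xe : x * e = ((q : k) ^ 2) • (e * x)} {ye : y * e = ((q : k) ^ 2)⁻¹ • (e * y)}
    {xf : x * f = ((q : k) ^ 2)⁻¹ • (f * x)} {yf : y * f = ((q : k) ^ 2) • (f * y)}
    {ef : e * f - f * e = ((q : k) - (q : k)⁻¹)⁻¹ • (x - y)}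

@[simp] theorem lift_E : lift e f x y comm reg reg' xe ye xf yf ef (E q) = e :=
  (RingQuot.liftAlgHom_mkAlgHom_apply k _ _ _).trans (by simp)
@[simp] theorem lift_F : lift e f x y comm reg reg' xe ye xf yf ef (F q) = f :=
  (RingQuot.liftAlgHom_mkAlgHom_apply k _ _ _).trans (by simp)
@[simp] theorem lift_K : lift e f x y comm reg reg' xe ye xf yf ef (K q) = x :=
  (RingQuot.liftAlgHom_mkAlgHom_apply k _ _ _).trans (by simp)
@[simp] theorem lift_Kb : lift e f x y comm reg reg' xe ye xf yf ef (Kb q) = y :=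
  (RingQuot.liftAlgHom_mkAlgHom_apply k _ _ _).trans (by simp)

theorem hom_ext {g h : WSl q →ₐ[k] B} (hE : g (E q) = h (E q)) (hF : g (F q) = h (F q))
    (hK : g (K q) = h (K q)) (hKb : g (Kb q) = h (Kb q)) : g = h := by
  refine RingQuot.ringQuot_ext' k _ _ (FreeAlgebra.hom_ext (funext fun i => ?_))
  cases i
  exacts [hE, hF, hK, hKb]

end lift

/-- Every element is reached from `1` by left multiplication with generators and linear
combinations. -/
theorem induction_left {P : WSl q → Prop} (one : P 1) (add : ∀ x y, P x → P y → P (x + y))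
    (smul : ∀ (c : k) x, P x → P (c • x)) (hE : ∀ x, P x → P (E q * x))
    (hF : ∀ x, P x → P (F q * x)) (hK : ∀ x, P x → P (K q * x))
    (hKb : ∀ x, P x → P (Kb q * x)) (a : WSl q) : P a := by
  obtain ⟨a, rfl⟩ := RingQuot.mkAlgHom_surjective k (WRel q) a
  suffices h : ∀ b, P b → P (mk q a * b) by
    have h1 := h 1 one
    rw [mul_one] at h1
    exact h1
  induction a with
  | grade0 r =>
    intro b hb
    rw [AlgHom.commutes, ← Algebra.smul_def]
    exact smul r b hb
  | grade1 g =>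
    cases g
    exacts [hE, hF, hK, hKb]
  | add a b ha hb =>
    intro x hx
    rw [map_add, add_mul]
    exact add _ _ (ha x hx) (hb x hx)
  | mul a b ha hb =>
    intro x hx
    rw [map_mul, mul_assoc]
    exact ha _ (hb x hx)

end WSl

namespace USl

variable (q : kˣ)

/-- The quotient map from the free algebra. -/
def mk : FreeAlgebra k Gen →ₐ[k] USl q := RingQuot.mkAlgHom k (URel q)

/-- The generator `E`. -/
def E : USl q := mk q (fr k .E)
/-- The generator `F`. -/
def F : USl q := mk q (fr k .F)
/-- The generator `K`. -/
def K : USl q := mk q (fr k .K)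
/-- The generator `K⁻¹`. -/
def Ki : USl q := mk q (fr k .Kb)

variable {q}

theorem mk_rel {a b : FreeAlgebra k Gen} (h : URel q a b) : mk q a = mk q b :=
  RingQuot.mkAlgHom_rel k h

theorem inv : Ki q * K q = 1 := by
  have h := mk_rel (URel.inv (q := q))
  simp only [map_mul, map_one] at h
  exact h
theorem inv' : K q * Ki q = 1 := by
  have h := mk_rel (URel.inv' (q := q))
  simp only [map_mul, map_one] at h
  exact h
theorem KEKi : K q * E q * Ki q = ((q : k) ^ 2) • E q := by
  have h := mk_rel (URel.KE (q := q))
  simp only [map_mul, map_smul] at h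
  exact h
theorem KFKi : K q * F q * Ki q = ((q : k) ^ 2)⁻¹ • F q := by
  have h := mk_rel (URel.KF (q := q))
  simp only [map_mul, map_smul] at h
  exact h
theorem EF : E q * F q - F q * E q = ((q : k) - (q : k)⁻¹)⁻¹ • (K q - Ki q) := by
  have h := mk_rel (URel.EF (q := q))
  simp only [map_mul, map_smul, map_sub] at h
  exact h

theorem KE : K q * E q = ((q : k) ^ 2) • (E q * K q) := by
  rw [← smul_mul_assoc, ← KEKi, mul_assoc, inv, mul_one]
theorem KF : K q * F q = ((q : k) ^ 2)⁻¹ • (F q * K q) := by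
  rw [← smul_mul_assoc, ← KFKi, mul_assoc, inv, mul_one]
theorem KiE : Ki q * E q = ((q : k) ^ 2)⁻¹ • (E q * Ki q) := by
  have h : Ki q * (K q * E q * Ki q) = E q * Ki q := by
    rw [mul_assoc, ← mul_assoc, inv, one_mul]
  rw [← h, KEKi, mul_smul_comm, inv_smul_smul₀ (pow_ne_zero 2 q.ne_zero)]
theorem KiF : Ki q * F q = ((q : k) ^ 2) • (F q * Ki q) := by
  have h : Ki q * (K q * F q * Ki q) = F q * Ki q := by
    rw [mul_assoc, ← mul_assoc, inv, one_mul]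
  rw [← h, KFKi, mul_smul_comm, smul_inv_smul₀ (pow_ne_zero 2 q.ne_zero)]

/-- Universal property: four elements of an algebra that satisfy the defining relations define an
algebra morphism. -/
def lift {B : Type*} [Ring B] [Algebra k B] (e f x y : B)
    (inv : y * x = 1) (inv' : x * y = 1)
    (xe : x * e * y = ((q : k) ^ 2) • e) (xf : x * f * y = ((q : k) ^ 2)⁻¹ • f)
    (ef : e * f - f * e = ((q : k) - (q : k)⁻¹)⁻¹ • (x - y)) : USl q →ₐ[k] B :=
  RingQuot.liftAlgHom k ⟨FreeAlgebra.lift k (fun g => Gen.casesOn g e f x y), by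
    intro a b h
    cases h <;> simp only [map_mul, map_smul, map_sub, map_one, FreeAlgebra.lift_ι_apply] <;>
      assumption⟩

section lift
variable {B : Type*} [Ring B] [Algebra k B] {e f x y : B}
    {inv : y * x = 1} {inv' : x * y = 1}
    {xe : x * e * y = ((q : k) ^ 2) • e} {xf : x * f * y = ((q : k) ^ 2)⁻¹ • f}
    {ef : e * f - f * e = ((q : k) - (q : k)⁻¹)⁻¹ • (x - y)}

@[simp] theorem lift_E : lift e f x y inv inv' xe xf ef (E q) = e :=
  (RingQuot.liftAlgHom_mkAlgHom_apply k _ _ _).trans (by simp)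
@[simp] theorem lift_F : lift e f x y inv inv' xe xf ef (F q) = f :=
  (RingQuot.liftAlgHom_mkAlgHom_apply k _ _ _).trans (by simp)
@[simp] theorem lift_K : lift e f x y inv inv' xe xf ef (K q) = x :=
  (RingQuot.liftAlgHom_mkAlgHom_apply k _ _ _).trans (by simp)
@[simp] theorem lift_Ki : lift e f x y inv inv' xe xf ef (Ki q) = y :=
  (RingQuot.liftAlgHom_mkAlgHom_apply k _ _ _).trans (by simp)

theorem hom_ext {g h : USl q →ₐ[k] B} (hE : g (E q) = h (E q)) (hF : g (F q) = h (F q))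
    (hK : g (K q) = h (K q)) (hKi : g (Ki q) = h (Ki q)) : g = h := by
  refine RingQuot.ringQuot_ext' k _ _ (FreeAlgebra.hom_ext (funext fun i => ?_))
  cases i
  exacts [hE, hF, hK, hKi]

end lift

/-- A property that is stable under linear combinations and products and holds for the generators
holds everywhere. -/
theorem induction {P : USl q → Prop} (one : P 1) (add : ∀ x y, P x → P y → P (x + y))
    (smul : ∀ (c : k) x, P x → P (c • x)) (mul : ∀ x y, P x → P y → P (x * y))
    (hE : P (E q)) (hF : P (F q)) (hK : P (K q)) (hKi : P (Ki q)) (a : USl q) : P a := by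
  obtain ⟨a, rfl⟩ := RingQuot.mkAlgHom_surjective k (URel q) a
  induction a with
  | grade0 r =>
    rw [AlgHom.commutes, Algebra.algebraMap_eq_smul_one]
    exact smul r 1 one
  | grade1 g =>
    cases g
    exacts [hE, hF, hK, hKi]
  | add a b ha hb =>
    rw [map_add]
    exact add _ _ ha hb
  | mul a b ha hb =>
    rw [map_mul]
    exact mul _ _ ha hb

end USl

/-! ### The bialgebra `wsl_q(2)` and its weak antipode -/

/-- In a tensor product of two algebras, the coproducts of `E` and `F` satisfy the `EF` relation
as soon as both factors satisfy the relations. -/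
theorem comul_EF {A : Type*} [Ring A] [Algebra k A] {c s : k} {e f x y : A}
    (xf : x * f = s • (f * x)) (ye : y * e = s • (e * y))
    (ef : e * f - f * e = c • (x - y)) :
    ((1 : A) ⊗ₜ[k] e + e ⊗ₜ[k] x) * (f ⊗ₜ[k] (1 : A) + y ⊗ₜ[k] f) -
      (f ⊗ₜ[k] (1 : A) + y ⊗ₜ[k] f) * ((1 : A) ⊗ₜ[k] e + e ⊗ₜ[k] x) =
      c • (x ⊗ₜ[k] x - y ⊗ₜ[k] y) := by
  have h1 : (e * y) ⊗ₜ[k] (x * f) = (y * e) ⊗ₜ[k] (f * x) := by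
    rw [xf, ye, TensorProduct.tmul_smul, TensorProduct.smul_tmul']
  have h2 : y ⊗ₜ[k] (e * f) - y ⊗ₜ[k] (f * e) = c • (y ⊗ₜ[k] x - y ⊗ₜ[k] y) := by
    rw [← TensorProduct.tmul_sub, ef, TensorProduct.tmul_smul, TensorProduct.tmul_sub]
  have h3 : (e * f) ⊗ₜ[k] x - (f * e) ⊗ₜ[k] x = c • (x ⊗ₜ[k] x - y ⊗ₜ[k] x) := by
    rw [← TensorProduct.sub_tmul, ef, ← TensorProduct.smul_tmul', TensorProduct.sub_tmul]
  have h4 : c • (x ⊗ₜ[k] x - y ⊗ₜ[k] y) =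
      c • (y ⊗ₜ[k] x - y ⊗ₜ[k] y) + c • (x ⊗ₜ[k] x - y ⊗ₜ[k] x) := by
    rw [← smul_add]; congr 1; abel
  rw [h4, ← h2, ← h3]
  simp only [mul_add, add_mul, Algebra.TensorProduct.tmul_mul_tmul, one_mul, mul_one, h1]
  abel

theorem comul_xe {A : Type*} [Ring A] [Algebra k A] {s : k} {e x x' : A}
    (xe : x' * e = s • (e * x')) (c : x' * x = x * x') :
    (x' ⊗ₜ[k] x') * ((1 : A) ⊗ₜ[k] e + e ⊗ₜ[k] x) =
      s • (((1 : A) ⊗ₜ[k] e + e ⊗ₜ[k] x) * (x' ⊗ₜ[k] x')) := by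
  simp only [mul_add, add_mul, Algebra.TensorProduct.tmul_mul_tmul, one_mul, mul_one, xe, c,
    TensorProduct.tmul_smul, smul_add, ← TensorProduct.smul_tmul']

theorem comul_xf {A : Type*} [Ring A] [Algebra k A] {s : k} {f y x' : A}
    (xf : x' * f = s • (f * x')) (c : x' * y = y * x') :
    (x' ⊗ₜ[k] x') * (f ⊗ₜ[k] (1 : A) + y ⊗ₜ[k] f) =
      s • ((f ⊗ₜ[k] (1 : A) + y ⊗ₜ[k] f) * (x' ⊗ₜ[k] x')) := by
  simp only [mul_add, add_mul, Algebra.TensorProduct.tmul_mul_tmul, one_mul, mul_one, xf, c,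
    TensorProduct.tmul_smul, smul_add, ← TensorProduct.smul_tmul']

section Antipode

variable {A : Type*} [Ring A] [Bialgebra k A] {S : A →ₗ[k] A}

/-- The left antipode axiom for an anti-multiplicative map is stable under products. -/
theorem antipode_left_mul (hS : ∀ x y, S (x * y) = S y * S x) {x y : A}
    (hx : LinearMap.mul' k A (S.rTensor A (Coalgebra.comul x)) =
      algebraMap k A (Coalgebra.counit x))
    (hy : LinearMap.mul' k A (S.rTensor A (Coalgebra.comul y)) =
      algebraMap k A (Coalgebra.counit y)) :
    LinearMap.mul' k A (S.rTensor A (Coalgebra.comul (x * y))) =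
      algebraMap k A (Coalgebra.counit (x * y)) := by
  have key : ∀ (t u : A ⊗[k] A) (c : k), LinearMap.mul' k A (S.rTensor A t) = algebraMap k A c →
      LinearMap.mul' k A (S.rTensor A (t * u)) = c • LinearMap.mul' k A (S.rTensor A u) := by
    intro t u c ht
    induction u with
    | zero => simp
    | add u v hu hv => rw [mul_add, map_add, map_add, hu, hv, map_add, map_add, smul_add]
    | tmul a b =>
      have h : LinearMap.mul' k A (S.rTensor A (t * a ⊗ₜ[k] b)) =
          S a * LinearMap.mul' k A (S.rTensor A t) * b := by
        clear ht
        induction t with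
        | zero => simp
        | add u v hu hv =>
          rw [add_mul, map_add, map_add, hu, hv, map_add, map_add, mul_add, add_mul]
        | tmul x y => simp [hS, mul_assoc]
      rw [h, ht, ← Algebra.commutes, mul_assoc, ← Algebra.smul_def]
      simp
  rw [Bialgebra.comul_mul, key _ _ _ hx, hy, Bialgebra.counit_mul, map_mul, Algebra.smul_def]

/-- The right antipode axiom for an anti-multiplicative map is stable under products. -/
theorem antipode_right_mul (hS : ∀ x y, S (x * y) = S y * S x) {x y : A}
    (hx : LinearMap.mul' k A (S.lTensor A (Coalgebra.comul x)) =
      algebraMap k A (Coalgebra.counit x))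
    (hy : LinearMap.mul' k A (S.lTensor A (Coalgebra.comul y)) =
      algebraMap k A (Coalgebra.counit y)) :
    LinearMap.mul' k A (S.lTensor A (Coalgebra.comul (x * y))) =
      algebraMap k A (Coalgebra.counit (x * y)) := by
  have key : ∀ (t u : A ⊗[k] A) (c : k), LinearMap.mul' k A (S.lTensor A u) = algebraMap k A c →
      LinearMap.mul' k A (S.lTensor A (t * u)) = c • LinearMap.mul' k A (S.lTensor A t) := by
    intro t u c hu
    induction t with
    | zero => simp
    | add u v hu hv => rw [add_mul, map_add, map_add, hu, hv, map_add, map_add, smul_add]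
    | tmul a b =>
      have h : LinearMap.mul' k A (S.lTensor A (a ⊗ₜ[k] b * u)) =
          a * LinearMap.mul' k A (S.lTensor A u) * S b := by
        clear hu
        induction u with
        | zero => simp
        | add u v hu hv =>
          rw [mul_add, map_add, map_add, hu, hv, map_add, map_add, mul_add, add_mul]
        | tmul x y => simp [hS, mul_assoc]
      rw [h, hu, ← Algebra.commutes, mul_assoc, ← Algebra.smul_def]
      simp
  rw [Bialgebra.comul_mul, key _ _ _ hy, hx, Bialgebra.counit_mul, mul_comm, map_mul,
    Algebra.smul_def]

end Antipode

namespace WSl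

variable (q : kˣ)

/-- The comultiplication `Δ_w`. -/
def comulHom : WSl q →ₐ[k] WSl q ⊗[k] WSl q :=
  lift ((1 : WSl q) ⊗ₜ[k] E q + E q ⊗ₜ[k] K q) (F q ⊗ₜ[k] (1 : WSl q) + Kb q ⊗ₜ[k] F q)
    (K q ⊗ₜ[k] K q) (Kb q ⊗ₜ[k] Kb q)
    (by simp only [Algebra.TensorProduct.tmul_mul_tmul, comm])
    (by simp only [Algebra.TensorProduct.tmul_mul_tmul, reg])
    (by simp only [Algebra.TensorProduct.tmul_mul_tmul, reg'])
    (comul_xe KE rfl) (comul_xe KbE comm.symm) (comul_xf KF comm) (comul_xf KbF rfl)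
    (comul_EF KF KbE EF)

/-- The counit `ε_w`. -/
def counitHom : WSl q →ₐ[k] k :=
  lift 0 0 1 1 (by simp) (by simp) (by simp) (by simp) (by simp) (by simp) (by simp) (by simp)

@[simp] theorem comulHom_E : comulHom q (E q) = 1 ⊗ₜ[k] E q + E q ⊗ₜ[k] K q :=
  (RingQuot.liftAlgHom_mkAlgHom_apply k _ _ _).trans (by simp)
@[simp] theorem comulHom_F : comulHom q (F q) = F q ⊗ₜ[k] 1 + Kb q ⊗ₜ[k] F q :=
  (RingQuot.liftAlgHom_mkAlgHom_apply k _ _ _).trans (by simp)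
@[simp] theorem comulHom_K : comulHom q (K q) = K q ⊗ₜ[k] K q :=
  (RingQuot.liftAlgHom_mkAlgHom_apply k _ _ _).trans (by simp)
@[simp] theorem comulHom_Kb : comulHom q (Kb q) = Kb q ⊗ₜ[k] Kb q :=
  (RingQuot.liftAlgHom_mkAlgHom_apply k _ _ _).trans (by simp)
@[simp] theorem counitHom_E : counitHom q (E q) = 0 :=
  (RingQuot.liftAlgHom_mkAlgHom_apply k _ _ _).trans (by simp)
@[simp] theorem counitHom_F : counitHom q (F q) = 0 :=
  (RingQuot.liftAlgHom_mkAlgHom_apply k _ _ _).trans (by simp)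
@[simp] theorem counitHom_K : counitHom q (K q) = 1 :=
  (RingQuot.liftAlgHom_mkAlgHom_apply k _ _ _).trans (by simp)
@[simp] theorem counitHom_Kb : counitHom q (Kb q) = 1 :=
  (RingQuot.liftAlgHom_mkAlgHom_apply k _ _ _).trans (by simp)

instance : Bialgebra k (WSl q) :=
  Bialgebra.ofAlgHom (comulHom q) (counitHom q)
    (by
      apply hom_ext <;>
      simp [TensorProduct.tmul_add, TensorProduct.add_tmul,
        Algebra.TensorProduct.one_def, add_assoc])
    (by apply hom_ext <;> simp)
    (by apply hom_ext <;> simp)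

/-- The weak antipode `T_w` as an algebra morphism into the opposite algebra. -/
def weakAntipodeHom : WSl q →ₐ[k] (WSl q)ᵐᵒᵖ :=
  lift (.op (-(E q * Kb q))) (.op (-(K q * F q))) (.op (Kb q)) (.op (K q))
    (by simp only [← MulOpposite.op_mul, comm])
    (by simp only [← MulOpposite.op_mul, ← mul_assoc, reg'])
    (by simp only [← MulOpposite.op_mul, ← mul_assoc, reg])
    (by
      simp only [← MulOpposite.op_mul, ← MulOpposite.op_smul, neg_mul, mul_neg]
      rw [← mul_assoc, KbE, smul_mul_assoc, smul_neg,
        smul_inv_smul₀ (pow_ne_zero 2 q.ne_zero)])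
    (by
      simp only [← MulOpposite.op_mul, ← MulOpposite.op_smul, neg_mul, mul_neg]
      rw [← mul_assoc, KE, smul_mul_assoc, smul_neg,
        inv_smul_smul₀ (pow_ne_zero 2 q.ne_zero), mul_assoc, mul_assoc, comm])
    (by
      simp only [← MulOpposite.op_mul, ← MulOpposite.op_smul, neg_mul, mul_neg]
      rw [← mul_assoc, ← comm, mul_assoc, mul_assoc, KbF, mul_smul_comm, smul_neg,
        inv_smul_smul₀ (pow_ne_zero 2 q.ne_zero)])
    (by
      simp only [← MulOpposite.op_mul, ← MulOpposite.op_smul, neg_mul, mul_neg]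
      rw [mul_assoc, KF, mul_smul_comm, smul_neg,
        smul_inv_smul₀ (pow_ne_zero 2 q.ne_zero)])
    (by
      simp only [← MulOpposite.op_mul, ← MulOpposite.op_smul, ← MulOpposite.op_sub, neg_mul,
        mul_neg, neg_neg]
      have h1 : K q * F q * (E q * Kb q) = F q * E q * (K q * Kb q) := by
        rw [KF, smul_mul_assoc, mul_assoc, ← mul_assoc (K q), KE,
          smul_mul_assoc, mul_smul_comm, inv_smul_smul₀ (pow_ne_zero 2 q.ne_zero)]
        simp only [mul_assoc]
      have h2 : E q * Kb q * (K q * F q) = E q * F q * (K q * Kb q) := by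
        rw [KF, mul_smul_comm, mul_assoc, ← mul_assoc (Kb q), KbF, smul_mul_assoc, mul_smul_comm,
          inv_smul_smul₀ (pow_ne_zero 2 q.ne_zero), comm]
        simp only [mul_assoc]
      have h3 : (K q - Kb q) * (K q * Kb q) = K q - Kb q := by
        rw [sub_mul, ← mul_assoc (Kb q), reg', comm, ← mul_assoc, reg]
      rw [h1, h2, ← sub_mul, ← neg_sub (E q * F q), neg_mul, EF, smul_mul_assoc, h3, ← smul_neg,
        neg_sub, MulOpposite.op_smul, MulOpposite.op_sub])

/-- The weak antipode `T_w`: the linear map underlying the anti-automorphism. -/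
def weakAntipode : WSl q →ₗ[k] WSl q :=
  (MulOpposite.opLinearEquiv k).symm.toLinearMap ∘ₗ (weakAntipodeHom q).toLinearMap

/-! ### The subspace `W` -/

/-- The linear span of `E^i F^j K^l`, `E^i F^j K̄^m` and `E^i F^j J` with `i, j ≥ 0` and
`l, m > 0`. -/
def W : Submodule k (WSl q) :=
  Submodule.span k
    ({x | ∃ i j l : ℕ, 0 < l ∧ x = E q ^ i * F q ^ j * K q ^ l} ∪
      {x | ∃ i j m : ℕ, 0 < m ∧ x = E q ^ i * F q ^ j * Kb q ^ m} ∪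
      {x | ∃ i j : ℕ, x = E q ^ i * F q ^ j * J q})

variable {q}

theorem J_mul_K : J q * K q = K q := reg
theorem J_mul_Kb : J q * Kb q = Kb q := by rw [J, comm, reg']
theorem J_mul_J : J q * J q = J q := by rw [J, ← mul_assoc, reg]
theorem K_mul_J : K q * J q = K q := by rw [J, comm, ← mul_assoc, reg]
theorem Kb_mul_J : Kb q * J q = Kb q := by rw [J, ← mul_assoc, reg']
theorem J_mul_E : J q * E q = E q * J q := by
  rw [J, mul_assoc, KbE, mul_smul_comm, ← mul_assoc, KE, smul_mul_assoc,
    inv_smul_smul₀ (pow_ne_zero 2 q.ne_zero), mul_assoc]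
theorem J_mul_F : J q * F q = F q * J q := by
  rw [J, mul_assoc, KbF, mul_smul_comm, ← mul_assoc, KF, smul_mul_assoc,
    smul_inv_smul₀ (pow_ne_zero 2 q.ne_zero), mul_assoc]

/-- `J` is central. -/
theorem J_comm (a : WSl q) : J q * a = a * J q := by
  refine induction_left (P := fun a => J q * a = a * J q) (by simp) ?_ ?_ ?_ ?_ ?_ ?_ a
  · intro x y hx hy
    rw [mul_add, add_mul, hx, hy]
  · intro c x hx
    rw [mul_smul_comm, smul_mul_assoc, hx]
  · intro x hx
    rw [← mul_assoc, J_mul_E, mul_assoc, hx, mul_assoc]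
  · intro x hx
    rw [← mul_assoc, J_mul_F, mul_assoc, hx, mul_assoc]
  · intro x hx
    rw [← mul_assoc, J_mul_K, mul_assoc, ← hx, ← mul_assoc, K_mul_J]
  · intro x hx
    rw [← mul_assoc, J_mul_Kb, mul_assoc, ← hx, ← mul_assoc, Kb_mul_J]

/-- Elements that may stand at the right end of the monomials spanning `W`. -/
inductive Tail (q : kˣ) : WSl q → Prop
  | K (l : ℕ) : Tail q (K q ^ (l + 1))
  | Kb (l : ℕ) : Tail q (Kb q ^ (l + 1))
  | J : Tail q (J q)

theorem tail_mem_W {t : WSl q} (ht : Tail q t) (i j : ℕ) : E q ^ i * F q ^ j * t ∈ W q := by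
  apply Submodule.subset_span
  cases ht with
  | K l => exact .inl (.inl ⟨i, j, l + 1, l.succ_pos, rfl⟩)
  | Kb l => exact .inl (.inr ⟨i, j, l + 1, l.succ_pos, rfl⟩)
  | J => exact .inr ⟨i, j, rfl⟩

theorem W_induction {P : WSl q → Prop} (zero : P 0) (add : ∀ x y, P x → P y → P (x + y))
    (smul : ∀ (c : k) x, P x → P (c • x))
    (mon : ∀ i j t, Tail q t → P (E q ^ i * F q ^ j * t)) {w : WSl q} (hw : w ∈ W q) : P w := by
  refine Submodule.span_induction ?_ zero (fun x y _ _ => add x y) (fun c x _ => smul c x) hw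
  rintro x ((⟨i, j, l, hl, rfl⟩ | ⟨i, j, l, hl, rfl⟩) | ⟨i, j, rfl⟩)
  · obtain ⟨l, rfl⟩ := Nat.exists_eq_succ_of_ne_zero hl.ne'
    exact mon i j _ (.K l)
  · obtain ⟨l, rfl⟩ := Nat.exists_eq_succ_of_ne_zero hl.ne'
    exact mon i j _ (.Kb l)
  · exact mon i j _ .J

theorem W_J_mul {w : WSl q} (hw : w ∈ W q) : J q * w = w := by
  refine W_induction (P := fun w => J q * w = w) (mul_zero _) ?_ ?_ ?_ hw
  · intro x y hx hy
    rw [mul_add, hx, hy]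
  · intro c x hx
    rw [mul_smul_comm, hx]
  · intro i j t ht
    rw [← mul_assoc, J_comm, mul_assoc]
    congr 1
    cases ht with
    | K l => rw [pow_succ', ← mul_assoc, J_mul_K]
    | Kb l => rw [pow_succ', ← mul_assoc, J_mul_Kb]
    | J => exact J_mul_J

theorem Tail.K_mul {t : WSl q} (ht : Tail q t) : Tail q (WSl.K q * t) := by
  cases ht with
  | K l => rw [← pow_succ']; exact .K _
  | Kb l =>
    cases l with
    | zero => rw [zero_add, pow_one]; exact .J
    | succ l =>
      rw [pow_succ', pow_succ', ← mul_assoc, ← mul_assoc, ← WSl.J, J_mul_Kb, ← pow_succ']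
      exact .Kb l
  | J => rw [K_mul_J]; simpa using Tail.K (q := q) 0

theorem Tail.Kb_mul {t : WSl q} (ht : Tail q t) : Tail q (WSl.Kb q * t) := by
  cases ht with
  | Kb l => rw [← pow_succ']; exact .Kb _
  | K l =>
    cases l with
    | zero => rw [zero_add, pow_one, ← comm]; exact .J
    | succ l =>
      rw [pow_succ', pow_succ', ← mul_assoc, ← mul_assoc, ← comm, ← WSl.J, J_mul_K, ← pow_succ']
      exact .K l
  | J => rw [Kb_mul_J]; simpa using Tail.Kb (q := q) 0

theorem K_mul_E_pow (i : ℕ) : K q * E q ^ i = (((q : k) ^ 2) ^ i) • (E q ^ i * K q) := by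
  induction i with
  | zero => simp
  | succ i ih =>
    rw [pow_succ (E q), ← mul_assoc, ih, smul_mul_assoc, mul_assoc, KE, mul_smul_comm, smul_smul,
      mul_assoc, ← pow_succ]
theorem Kb_mul_E_pow (i : ℕ) : Kb q * E q ^ i = ((((q : k) ^ 2)⁻¹) ^ i) • (E q ^ i * Kb q) := by
  induction i with
  | zero => simp
  | succ i ih =>
    rw [pow_succ (E q), ← mul_assoc, ih, smul_mul_assoc, mul_assoc, KbE, mul_smul_comm, smul_smul,
      mul_assoc, ← pow_succ]
theorem K_mul_F_pow (i : ℕ) : K q * F q ^ i = ((((q : k) ^ 2)⁻¹) ^ i) • (F q ^ i * K q) := by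
  induction i with
  | zero => simp
  | succ i ih =>
    rw [pow_succ (F q), ← mul_assoc, ih, smul_mul_assoc, mul_assoc, KF, mul_smul_comm, smul_smul,
      mul_assoc, ← pow_succ]
theorem Kb_mul_F_pow (i : ℕ) : Kb q * F q ^ i = (((q : k) ^ 2) ^ i) • (F q ^ i * Kb q) := by
  induction i with
  | zero => simp
  | succ i ih =>
    rw [pow_succ (F q), ← mul_assoc, ih, smul_mul_assoc, mul_assoc, KbF, mul_smul_comm, smul_smul,
      mul_assoc, ← pow_succ]

theorem E_mul_mem {w : WSl q} (hw : w ∈ W q) : E q * w ∈ W q := by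
  refine W_induction (P := fun w => E q * w ∈ W q) (by simp) ?_ ?_ ?_ hw
  · intro x y hx hy
    rw [mul_add]
    exact add_mem hx hy
  · intro c x hx
    rw [mul_smul_comm]
    exact (W q).smul_mem c hx
  · intro i j t ht
    rw [← mul_assoc, ← mul_assoc, ← pow_succ']
    exact tail_mem_W ht _ _

theorem K_mul_mem {w : WSl q} (hw : w ∈ W q) : K q * w ∈ W q := by
  refine W_induction (P := fun w => K q * w ∈ W q) (by simp) ?_ ?_ ?_ hw
  · intro x y hx hy
    rw [mul_add]
    exact add_mem hx hy
  · intro c x hx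
    rw [mul_smul_comm]
    exact (W q).smul_mem c hx
  · intro i j t ht
    rw [← mul_assoc, ← mul_assoc, K_mul_E_pow, smul_mul_assoc, mul_assoc _ (K q), K_mul_F_pow,
      mul_smul_comm, smul_mul_assoc, smul_mul_assoc, ← mul_assoc, mul_assoc _ (K q)]
    exact (W q).smul_mem _ ((W q).smul_mem _ (tail_mem_W ht.K_mul _ _))

theorem Kb_mul_mem {w : WSl q} (hw : w ∈ W q) : Kb q * w ∈ W q := by
  refine W_induction (P := fun w => Kb q * w ∈ W q) (by simp) ?_ ?_ ?_ hw
  · intro x y hx hy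
    rw [mul_add]
    exact add_mem hx hy
  · intro c x hx
    rw [mul_smul_comm]
    exact (W q).smul_mem c hx
  · intro i j t ht
    rw [← mul_assoc, ← mul_assoc, Kb_mul_E_pow, smul_mul_assoc, mul_assoc _ (Kb q), Kb_mul_F_pow,
      mul_smul_comm, smul_mul_assoc, smul_mul_assoc, ← mul_assoc, mul_assoc _ (Kb q)]
    exact (W q).smul_mem _ ((W q).smul_mem _ (tail_mem_W ht.Kb_mul _ _))

theorem F_mul_mem {w : WSl q} (hw : w ∈ W q) : F q * w ∈ W q := by
  refine W_induction (P := fun w => F q * w ∈ W q) (by simp) ?_ ?_ ?_ hw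
  · intro x y hx hy
    rw [mul_add]
    exact add_mem hx hy
  · intro c x hx
    rw [mul_smul_comm]
    exact (W q).smul_mem c hx
  · intro i j t ht
    induction i with
    | zero =>
      rw [pow_zero, one_mul, ← mul_assoc, ← pow_succ', ← one_mul (F q ^ (j + 1)), ← pow_zero (E q)]
      exact tail_mem_W ht _ _
    | succ i ih =>
      have h : F q * E q = E q * F q - ((q : k) - (q : k)⁻¹)⁻¹ • (K q - Kb q) := by
        rw [← EF, sub_sub_cancel]
      have h' := tail_mem_W ht i j
      rw [pow_succ', mul_assoc (E q), mul_assoc (E q), ← mul_assoc (F q), h, sub_mul,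
        mul_assoc (E q), smul_mul_assoc, sub_mul]
      exact sub_mem (E_mul_mem ih)
        ((W q).smul_mem _ (sub_mem (K_mul_mem h') (Kb_mul_mem h')))

theorem J_mem : J q ∈ W q := by simpa using tail_mem_W (Tail.J (q := q)) 0 0

theorem mul_mem_W (a : WSl q) {w : WSl q} (hw : w ∈ W q) : a * w ∈ W q := by
  refine induction_left (P := fun a => a * w ∈ W q) (by simpa using hw) ?_ ?_ ?_ ?_ ?_ ?_ a
  · intro x y hx hy
    rw [add_mul]
    exact add_mem hx hy
  · intro c x hx
    rw [smul_mul_assoc]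
    exact (W q).smul_mem c hx
  all_goals
    intro x hx
    rw [mul_assoc]
  exacts [E_mul_mem hx, F_mul_mem hx, K_mul_mem hx, Kb_mul_mem hx]

variable (q)

/-- `W` with the multiplication of `wsl_q(2)` and the unit `J`. -/
instance : Ring (W q) :=
  { (inferInstance : AddCommGroup (W q)) with
    mul := fun x y => ⟨x.1 * y.1, mul_mem_W x.1 y.2⟩
    one := ⟨J q, J_mem⟩
    mul_assoc := fun _ _ _ => Subtype.ext (mul_assoc _ _ _)
    one_mul := fun x => Subtype.ext (W_J_mul x.2)
    mul_one := fun x => Subtype.ext ((J_comm x.1).symm.trans (W_J_mul x.2))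
    left_distrib := fun _ _ _ => Subtype.ext (mul_add _ _ _)
    right_distrib := fun _ _ _ => Subtype.ext (add_mul _ _ _)
    zero_mul := fun _ => Subtype.ext (zero_mul _)
    mul_zero := fun _ => Subtype.ext (mul_zero _) }

instance : Algebra k (W q) :=
  Algebra.ofModule (fun _ _ _ => Subtype.ext (smul_mul_assoc _ _ _))
    (fun _ _ _ => Subtype.ext (mul_smul_comm _ _ _))

end WSl

/-! ### The Hopf algebra `U_q(sl_2)` -/

namespace USl

variable (q : kˣ)

theorem conj_eq {B : Type*} [Ring B] [Algebra k B] {x y e : B} {s : k} (h : x * y = 1)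
    (h' : x * e = s • (e * x)) : x * e * y = s • e := by
  rw [h', smul_mul_assoc, mul_assoc, h, mul_one]

/-- The comultiplication of `U_q(sl_2)`. -/
def comulHom : USl q →ₐ[k] USl q ⊗[k] USl q :=
  lift ((1 : USl q) ⊗ₜ[k] E q + E q ⊗ₜ[k] K q) (F q ⊗ₜ[k] (1 : USl q) + Ki q ⊗ₜ[k] F q)
    (K q ⊗ₜ[k] K q) (Ki q ⊗ₜ[k] Ki q)
    (by simp only [Algebra.TensorProduct.tmul_mul_tmul, inv, Algebra.TensorProduct.one_def])
    (by simp only [Algebra.TensorProduct.tmul_mul_tmul, inv', Algebra.TensorProduct.one_def])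
    (conj_eq (by simp only [Algebra.TensorProduct.tmul_mul_tmul, inv',
      Algebra.TensorProduct.one_def]) (comul_xe KE rfl))
    (conj_eq (by simp only [Algebra.TensorProduct.tmul_mul_tmul, inv',
      Algebra.TensorProduct.one_def]) (comul_xf KF (inv'.trans inv.symm)))
    (comul_EF KF KiE EF)

/-- The counit of `U_q(sl_2)`. -/
def counitHom : USl q →ₐ[k] k :=
  lift 0 0 1 1 (by simp) (by simp) (by simp) (by simp) (by simp)

@[simp] theorem comulHom_E : comulHom q (E q) = 1 ⊗ₜ[k] E q + E q ⊗ₜ[k] K q :=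
  (RingQuot.liftAlgHom_mkAlgHom_apply k _ _ _).trans (by simp)
@[simp] theorem comulHom_F : comulHom q (F q) = F q ⊗ₜ[k] 1 + Ki q ⊗ₜ[k] F q :=
  (RingQuot.liftAlgHom_mkAlgHom_apply k _ _ _).trans (by simp)
@[simp] theorem comulHom_K : comulHom q (K q) = K q ⊗ₜ[k] K q :=
  (RingQuot.liftAlgHom_mkAlgHom_apply k _ _ _).trans (by simp)
@[simp] theorem comulHom_Ki : comulHom q (Ki q) = Ki q ⊗ₜ[k] Ki q :=
  (RingQuot.liftAlgHom_mkAlgHom_apply k _ _ _).trans (by simp)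
@[simp] theorem counitHom_E : counitHom q (E q) = 0 :=
  (RingQuot.liftAlgHom_mkAlgHom_apply k _ _ _).trans (by simp)
@[simp] theorem counitHom_F : counitHom q (F q) = 0 :=
  (RingQuot.liftAlgHom_mkAlgHom_apply k _ _ _).trans (by simp)
@[simp] theorem counitHom_K : counitHom q (K q) = 1 :=
  (RingQuot.liftAlgHom_mkAlgHom_apply k _ _ _).trans (by simp)
@[simp] theorem counitHom_Ki : counitHom q (Ki q) = 1 :=
  (RingQuot.liftAlgHom_mkAlgHom_apply k _ _ _).trans (by simp)

instance : Bialgebra k (USl q) :=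
  Bialgebra.ofAlgHom (comulHom q) (counitHom q)
    (by
      apply hom_ext <;>
      simp [TensorProduct.tmul_add, TensorProduct.add_tmul,
        Algebra.TensorProduct.one_def, add_assoc])
    (by apply hom_ext <;> simp)
    (by apply hom_ext <;> simp)

/-- The antipode of `U_q(sl_2)` as an algebra morphism into the opposite algebra. -/
def antipodeHom : USl q →ₐ[k] (USl q)ᵐᵒᵖ :=
  lift (.op (-(E q * Ki q))) (.op (-(K q * F q))) (.op (Ki q)) (.op (K q))
    (by rw [← MulOpposite.op_mul, inv, MulOpposite.op_one])
    (by rw [← MulOpposite.op_mul, inv', MulOpposite.op_one])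
    (by
      simp only [← MulOpposite.op_mul, ← MulOpposite.op_smul, neg_mul, mul_neg, smul_neg]
      rw [← mul_assoc, ← mul_assoc, KEKi, smul_mul_assoc])
    (by
      simp only [← MulOpposite.op_mul, ← MulOpposite.op_smul, neg_mul, mul_neg, smul_neg]
      rw [KFKi, mul_smul_comm])
    (by
      simp only [← MulOpposite.op_mul, ← MulOpposite.op_smul, ← MulOpposite.op_sub, neg_mul,
        mul_neg, neg_neg]
      have h1 : K q * F q * (E q * Ki q) = F q * E q := by
        rw [KF, smul_mul_assoc, mul_assoc, ← mul_assoc (K q), KEKi, mul_smul_comm,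
          inv_smul_smul₀ (pow_ne_zero 2 q.ne_zero)]
      have h2 : E q * Ki q * (K q * F q) = E q * F q := by
        rw [mul_assoc, ← mul_assoc (Ki q), inv, one_mul]
      rw [h1, h2, ← neg_sub (E q * F q), EF, ← smul_neg,
        neg_sub, MulOpposite.op_smul, MulOpposite.op_sub])

@[simp] theorem antipodeHom_E : antipodeHom q (E q) = .op (-(E q * Ki q)) :=
  (RingQuot.liftAlgHom_mkAlgHom_apply k _ _ _).trans (by simp)
@[simp] theorem antipodeHom_F : antipodeHom q (F q) = .op (-(K q * F q)) :=
  (RingQuot.liftAlgHom_mkAlgHom_apply k _ _ _).trans (by simp)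
@[simp] theorem antipodeHom_K : antipodeHom q (K q) = .op (Ki q) :=
  (RingQuot.liftAlgHom_mkAlgHom_apply k _ _ _).trans (by simp)
@[simp] theorem antipodeHom_Ki : antipodeHom q (Ki q) = .op (K q) :=
  (RingQuot.liftAlgHom_mkAlgHom_apply k _ _ _).trans (by simp)

/-- The antipode of `U_q(sl_2)`. -/
def antipodeMap : USl q →ₗ[k] USl q :=
  (MulOpposite.opLinearEquiv k).symm.toLinearMap ∘ₗ (antipodeHom q).toLinearMap

variable {q}

theorem antipodeMap_apply (x : USl q) : antipodeMap q x = (antipodeHom q x).unop := rfl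

theorem antipodeMap_mul (x y : USl q) :
    antipodeMap q (x * y) = antipodeMap q y * antipodeMap q x := by
  simp [antipodeMap_apply]

@[simp] theorem comul_eq (x : USl q) : Coalgebra.comul (R := k) x = comulHom q x := rfl
@[simp] theorem counit_eq (x : USl q) : Coalgebra.counit (R := k) x = counitHom q x := rfl

theorem antipode_left (x : USl q) :
    LinearMap.mul' k _ ((antipodeMap q).rTensor _ (Coalgebra.comul x)) =
      algebraMap k _ (Coalgebra.counit x) := by
  refine induction
    (P := fun x => LinearMap.mul' k _ ((antipodeMap q).rTensor _ (Coalgebra.comul x)) =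
      algebraMap k _ (Coalgebra.counit x)) ?_ ?_ ?_ ?_ ?_ ?_ ?_ ?_ x
  · simp [antipodeMap_apply, Algebra.TensorProduct.one_def]
  · intro x y hx hy
    simp only [map_add, hx, hy]
  · intro c x hx
    simp only [map_smul, hx, Algebra.algebraMap_eq_smul_one, smul_smul, smul_eq_mul]
  · exact fun x y hx hy => antipode_left_mul antipodeMap_mul hx hy
  all_goals simp [antipodeMap_apply, inv, inv', mul_assoc]

theorem antipode_right (x : USl q) :
    LinearMap.mul' k _ ((antipodeMap q).lTensor _ (Coalgebra.comul x)) =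
      algebraMap k _ (Coalgebra.counit x) := by
  refine induction
    (P := fun x => LinearMap.mul' k _ ((antipodeMap q).lTensor _ (Coalgebra.comul x)) =
      algebraMap k _ (Coalgebra.counit x)) ?_ ?_ ?_ ?_ ?_ ?_ ?_ ?_ x
  · simp [antipodeMap_apply, Algebra.TensorProduct.one_def]
  · intro x y hx hy
    simp only [map_add, hx, hy]
  · intro c x hx
    simp only [map_smul, hx, Algebra.algebraMap_eq_smul_one, smul_smul, smul_eq_mul]
  · exact fun x y hx hy => antipode_right_mul antipodeMap_mul hx hy
  all_goals simp [antipodeMap_apply, inv, inv', ← mul_assoc]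

variable (q)

/-- The Hopf algebra `U_q(sl_2)`. -/
instance : HopfAlgebra k (USl q) where
  antipode := antipodeMap q
  mul_antipode_rTensor_comul := LinearMap.ext antipode_left
  mul_antipode_lTensor_comul := LinearMap.ext antipode_right

end USl

/-! ### The Hopf algebra structure of `W`, and the subspaces complementary to `W` -/

namespace WSl

variable (q : kˣ)

/-- The algebra morphism `a ↦ J a` from `wsl_q(2)` onto `W`. -/
def proj : WSl q →ₐ[k] W q :=
  AlgHom.ofLinearMap
    { toFun := fun a => ⟨J q * a, by rw [J_comm]; exact mul_mem_W a J_mem⟩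
      map_add' := fun x y => Subtype.ext (mul_add _ _ _)
      map_smul' := fun c x => Subtype.ext (mul_smul_comm _ _ _) }
    (Subtype.ext (mul_one _))
    (fun x y => Subtype.ext (by
      change J q * (x * y) = J q * x * (J q * y)
      rw [← mul_assoc (J q * x), mul_assoc (J q) x, ← J_comm x, ← mul_assoc (J q) (J q), J_mul_J,
        mul_assoc]))

variable {q}

theorem coe_proj (a : WSl q) : (proj q a : WSl q) = J q * a := rfl
theorem coe_mul (x y : W q) : ((x * y : W q) : WSl q) = x * y := rfl
theorem coe_one : ((1 : W q) : WSl q) = J q := rfl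

@[simp] theorem proj_coe (w : W q) : proj q w = w := Subtype.ext (W_J_mul w.2)

theorem proj_J : proj q (J q) = 1 := Subtype.ext J_mul_J

theorem proj_inv : proj q (K q) * proj q (Kb q) = 1 := by rw [← map_mul, ← J, proj_J]
theorem proj_inv' : proj q (Kb q) * proj q (K q) = 1 := by rw [← map_mul, ← comm, ← J, proj_J]

theorem W_hom_ext {B : Type*} [Ring B] [Algebra k B] {g h : W q →ₐ[k] B}
    (hgh : g.comp (proj q) = h.comp (proj q)) : g = h := by
  ext w
  have := DFunLike.congr_fun hgh (w : WSl q)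
  simpa using this

theorem map_proj_J : Algebra.TensorProduct.map (proj q) (proj q) (comulHom q (J q)) = 1 := by
  rw [J, map_mul, map_mul, comulHom_K, comulHom_Kb]
  simp [proj_inv, Algebra.TensorProduct.one_def]

theorem counitHom_J : counitHom q (J q) = 1 := by simp [J]

@[simp] theorem weakAntipodeHom_E : weakAntipodeHom q (E q) = .op (-(E q * Kb q)) :=
  (RingQuot.liftAlgHom_mkAlgHom_apply k _ _ _).trans (by simp)
@[simp] theorem weakAntipodeHom_F : weakAntipodeHom q (F q) = .op (-(K q * F q)) :=
  (RingQuot.liftAlgHom_mkAlgHom_apply k _ _ _).trans (by simp)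
@[simp] theorem weakAntipodeHom_K : weakAntipodeHom q (K q) = .op (Kb q) :=
  (RingQuot.liftAlgHom_mkAlgHom_apply k _ _ _).trans (by simp)
@[simp] theorem weakAntipodeHom_Kb : weakAntipodeHom q (Kb q) = .op (K q) :=
  (RingQuot.liftAlgHom_mkAlgHom_apply k _ _ _).trans (by simp)

theorem weakAntipode_apply (x : WSl q) : weakAntipode q x = (weakAntipodeHom q x).unop := rfl

theorem weakAntipode_mul (x y : WSl q) :
    weakAntipode q (x * y) = weakAntipode q y * weakAntipode q x := by
  simp [weakAntipode_apply]

theorem weakAntipode_J : weakAntipode q (J q) = J q := by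
  simp [J, weakAntipode_apply]

variable (q)

/-- The comultiplication of `W`: the restriction of `Δ_w`, which takes values in `W ⊗ W`; the
projection only adjusts the codomain. -/
def comulW : W q →ₐ[k] W q ⊗[k] W q :=
  AlgHom.ofLinearMap
    ((Algebra.TensorProduct.map (proj q) (proj q)).toLinearMap ∘ₗ (comulHom q).toLinearMap ∘ₗ
      (W q).subtype)
    map_proj_J
    (fun x y => by
      change Algebra.TensorProduct.map (proj q) (proj q) (comulHom q (x.1 * y.1)) = _
      rw [map_mul, map_mul]
      rfl)

/-- The counit of `W`: the restriction of `ε_w`. -/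
def counitW : W q →ₐ[k] k :=
  AlgHom.ofLinearMap ((counitHom q).toLinearMap ∘ₗ (W q).subtype) counitHom_J
    (fun x y => by simp [coe_mul])

/-- The antipode of `W`: the restriction of `T_w`, which maps `W` to `W`; the projection only
adjusts the codomain. -/
def antipodeW : W q →ₗ[k] W q :=
  (proj q).toLinearMap ∘ₗ weakAntipode q ∘ₗ (W q).subtype

variable {q}

@[simp] theorem comulW_proj (a : WSl q) :
    comulW q (proj q a) = Algebra.TensorProduct.map (proj q) (proj q) (comulHom q a) := by
  change Algebra.TensorProduct.map (proj q) (proj q) (comulHom q (J q * a)) = _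
  rw [map_mul, map_mul, map_proj_J, one_mul]

@[simp] theorem counitW_proj (a : WSl q) : counitW q (proj q a) = counitHom q a := by
  change counitHom q (J q * a) = _
  rw [map_mul, counitHom_J, one_mul]

@[simp] theorem antipodeW_proj (a : WSl q) : antipodeW q (proj q a) = proj q (weakAntipode q a) := by
  change proj q (weakAntipode q (J q * a)) = _
  rw [weakAntipode_mul, weakAntipode_J, map_mul, proj_J, mul_one]

@[simp] theorem antipodeW_one : antipodeW q 1 = 1 := by
  rw [← map_one (proj q), antipodeW_proj]
  simp [weakAntipode_apply]

theorem antipodeW_mul (x y : W q) : antipodeW q (x * y) = antipodeW q y * antipodeW q x := by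
  conv_lhs =>
    rw [← proj_coe x, ← proj_coe y, ← map_mul, antipodeW_proj, weakAntipode_mul, map_mul]
  rfl

variable (q)

instance : Bialgebra k (W q) :=
  Bialgebra.ofAlgHom (comulW q) (counitW q)
    (by
      apply W_hom_ext
      apply hom_ext <;>
      simp [TensorProduct.tmul_add, TensorProduct.add_tmul,
        Algebra.TensorProduct.one_def, add_assoc])
    (by
      apply W_hom_ext
      apply hom_ext <;> simp)
    (by
      apply W_hom_ext
      apply hom_ext <;> simp)

variable {q}

@[simp] theorem W_comul_eq (x : W q) : Coalgebra.comul (R := k) x = comulW q x := rfl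
@[simp] theorem W_counit_eq (x : W q) : Coalgebra.counit (R := k) x = counitW q x := rfl

theorem antipodeW_left (w : W q) :
    LinearMap.mul' k _ ((antipodeW q).rTensor _ (Coalgebra.comul w)) =
      algebraMap k _ (Coalgebra.counit w) := by
  have gen : ∀ g x : WSl q,
      LinearMap.mul' k _ ((antipodeW q).rTensor _ (Coalgebra.comul (proj q g))) =
        algebraMap k _ (Coalgebra.counit (proj q g)) →
      LinearMap.mul' k _ ((antipodeW q).rTensor _ (Coalgebra.comul (proj q x))) =
        algebraMap k _ (Coalgebra.counit (proj q x)) →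
      LinearMap.mul' k _ ((antipodeW q).rTensor _ (Coalgebra.comul (proj q (g * x)))) =
        algebraMap k _ (Coalgebra.counit (proj q (g * x))) := fun g x hg hx => by
    rw [map_mul]
    exact antipode_left_mul antipodeW_mul hg hx
  rw [← proj_coe w]
  refine induction_left
    (P := fun x => LinearMap.mul' k _ ((antipodeW q).rTensor _ (Coalgebra.comul (proj q x))) =
      algebraMap k _ (Coalgebra.counit (proj q x))) ?_ ?_ ?_ (fun x => gen _ x ?_)
      (fun x => gen _ x ?_) (fun x => gen _ x ?_) (fun x => gen _ x ?_) w
  · rw [W_comul_eq, W_counit_eq, comulW_proj, counitW_proj, map_one, map_one,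
      Algebra.TensorProduct.one_def, LinearMap.rTensor_tmul, ← map_one (proj q), antipodeW_proj]
    simp [weakAntipode_apply]
  · intro x y hx hy
    simp only [map_add, hx, hy]
  · intro c x hx
    simp only [map_smul, hx, Algebra.algebraMap_eq_smul_one, smul_smul, smul_eq_mul]
  all_goals simp [weakAntipode_apply, proj_inv, proj_inv', mul_assoc]

theorem antipodeW_right (w : W q) :
    LinearMap.mul' k _ ((antipodeW q).lTensor _ (Coalgebra.comul w)) =
      algebraMap k _ (Coalgebra.counit w) := by
  have gen : ∀ g x : WSl q,
      LinearMap.mul' k _ ((antipodeW q).lTensor _ (Coalgebra.comul (proj q g))) =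
        algebraMap k _ (Coalgebra.counit (proj q g)) →
      LinearMap.mul' k _ ((antipodeW q).lTensor _ (Coalgebra.comul (proj q x))) =
        algebraMap k _ (Coalgebra.counit (proj q x)) →
      LinearMap.mul' k _ ((antipodeW q).lTensor _ (Coalgebra.comul (proj q (g * x)))) =
        algebraMap k _ (Coalgebra.counit (proj q (g * x))) := fun g x hg hx => by
    rw [map_mul]
    exact antipode_right_mul antipodeW_mul hg hx
  rw [← proj_coe w]
  refine induction_left
    (P := fun x => LinearMap.mul' k _ ((antipodeW q).lTensor _ (Coalgebra.comul (proj q x))) =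
      algebraMap k _ (Coalgebra.counit (proj q x))) ?_ ?_ ?_ (fun x => gen _ x ?_)
      (fun x => gen _ x ?_) (fun x => gen _ x ?_) (fun x => gen _ x ?_) w
  · rw [W_comul_eq, W_counit_eq, comulW_proj, counitW_proj, map_one, map_one,
      Algebra.TensorProduct.one_def, LinearMap.lTensor_tmul, ← map_one (proj q), antipodeW_proj]
    simp [weakAntipode_apply]
  · intro x y hx hy
    simp only [map_add, hx, hy]
  · intro c x hx
    simp only [map_smul, hx, Algebra.algebraMap_eq_smul_one, smul_smul, smul_eq_mul]
  all_goals simp [weakAntipode_apply, proj_inv, proj_inv', ← mul_assoc]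

variable (q)

/-- `W` is a Hopf algebra with unit `J` and the structure maps of `wsl_q(2)`. -/
instance : HopfAlgebra k (W q) where
  antipode := antipodeW q
  mul_antipode_rTensor_comul := LinearMap.ext antipodeW_left
  mul_antipode_lTensor_comul := LinearMap.ext antipodeW_right

/-- The linear span of `E^i F^j`, `i, j ≥ 0`. -/
def spanEF : Submodule k (WSl q) :=
  Submodule.span k {x | ∃ i j : ℕ, x = E q ^ i * F q ^ j}

/-- The linear span of `(E (1 - J))^i (F (1 - J))^j`, `i, j ≥ 0`. -/
def Y : Submodule k (WSl q) :=
  Submodule.span k {x | ∃ i j : ℕ, x = (E q * (1 - J q)) ^ i * (F q * (1 - J q)) ^ j}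

end WSl

end WeakQuantum

end

open scoped TensorProduct

noncomputable section

namespace WeakQuantum

/-! ### The quotient by `W` is a polynomial ring. -/

namespace WSl

variable {k : Type*} [Field k] {q : kˣ}

/-! The element `J` is a central idempotent, and `W` is the ideal `J · wsl_q(2)`: it is a left ideal
containing `J`, and `J` acts on it as the identity. So `wsl_q(2)` splits along `J` and `1 - J`, and
the two factors can be identified separately.

On the factor `1 - J`, `K` and `K̄` vanish, so the `EF` relation says that `E` and `F` commute. The
quotient by `W` is therefore the polynomial ring in two variables, realised by `toPoly`, whose
kernel is exactly `W` (`toPoly_eq_zero_iff`). No PBW basis of `wsl_q(2)` is needed: independence of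
the monomials is read off in the polynomial ring, and spanning follows from moving `E` and `F` past
each other modulo `W` (`spanEF_sup_W`). Any family lifting the monomials then spans a complement of
`W` (`isCompl_span_W`), which covers both `spanEF` and `Y`.

On the factor `J`, the unit is `J = K K̄`, so `K` and `K̄` become inverse to each other and the
relations of `U_q` hold. This gives `toW : U_q → W`. Conversely the relations of `wsl_q(2)` hold in
`U_q`, which gives `ofWSl`, and its restriction to `W` inverts `toW`. Since `J` is group-like and
fixed by the weak antipode, the Hopf structure on `W` really is the restricted one
(`map_subtype_comul`, `coe_antipode`), and `toW` respects it by a check on generators. -/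

variable (q) in
/-- The algebra morphism to the polynomial ring in two variables that sends `E`, `F` to the
variables and kills `K` and `K̄`. -/
def toPoly : WSl q →ₐ[k] MvPolynomial (Fin 2) k :=
  lift (.X 0) (.X 1) 0 0 (by simp) (by simp) (by simp) (by simp) (by simp) (by simp) (by simp)
    -- With `K` and `K̄` sent to zero, the `EF` relation only asks that the two variables commute.
    (by rw [mul_comm, sub_self, sub_self, smul_zero])

@[simp] theorem toPoly_E : toPoly q (E q) = .X 0 := lift_E
@[simp] theorem toPoly_F : toPoly q (F q) = .X 1 := lift_F
@[simp] theorem toPoly_K : toPoly q (K q) = 0 := lift_K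
@[simp] theorem toPoly_Kb : toPoly q (Kb q) = 0 := lift_Kb
@[simp] theorem toPoly_J : toPoly q (J q) = 0 := by simp [J]

/-- The linear map from the polynomial ring that sends `X₀ ^ i * X₁ ^ j` to `b i j`. -/
def ofPoly (b : ℕ → ℕ → WSl q) : MvPolynomial (Fin 2) k →ₗ[k] WSl q :=
  (MvPolynomial.basisMonomials (Fin 2) k).constr k fun m => b (m 0) (m 1)

theorem ofPoly_X_pow_mul (b : ℕ → ℕ → WSl q) (i j : ℕ) :
    ofPoly b (.X 0 ^ i * .X 1 ^ j) = b i j := by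
  have h : (.X 0 ^ i * .X 1 ^ j : MvPolynomial (Fin 2) k) =
      MvPolynomial.basisMonomials (Fin 2) k (Finsupp.single 0 i + Finsupp.single 1 j) := by
    simp [MvPolynomial.X_pow_eq_monomial, MvPolynomial.monomial_mul]
  rw [h, ofPoly, Module.Basis.constr_basis]
  simp

/-- Makes `toPoly` injective on the span of any family lifting the monomials; this replaces a linear
independence argument inside `wsl_q(2)`. -/
theorem ofPoly_toPoly {b : ℕ → ℕ → WSl q}
    (hb : ∀ i j, toPoly q (b i j) = .X 0 ^ i * .X 1 ^ j) {a : WSl q}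
    (ha : a ∈ Submodule.span k {x | ∃ i j : ℕ, x = b i j}) : ofPoly b (toPoly q a) = a := by
  induction ha using Submodule.span_induction with
  | mem x hx =>
    obtain ⟨i, j, rfl⟩ := hx
    rw [hb, ofPoly_X_pow_mul]
  | zero => simp
  | add x y _ _ hx hy => rw [map_add, map_add, hx, hy]
  | smul c x _ hx => rw [map_smul, map_smul, hx]

/-- Since `w = J w` and `J` is central, `w a` equals `(w a) J`, a left multiple of `J ∈ W`. -/
theorem mem_W_mul (a : WSl q) {w : WSl q} (hw : w ∈ W q) : w * a ∈ W q := by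
  rw [← W_J_mul hw, J_comm, mul_assoc, J_comm, ← mul_assoc]
  exact mul_mem_W _ J_mem

theorem K_mem_W : K q ∈ W q := by simpa using tail_mem_W (.K (q := q) 0) 0 0

theorem Kb_mem_W : Kb q ∈ W q := by simpa using tail_mem_W (.Kb (q := q) 0) 0 0

theorem W_le_ker_toPoly : W q ≤ (toPoly q).toLinearMap.ker := by
  rw [W, Submodule.span_le]
  rintro x ((⟨i, j, l, hl, rfl⟩ | ⟨i, j, l, hl, rfl⟩) | ⟨i, j, rfl⟩)
  · simp [hl.ne']
  · simp [hl.ne']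
  · simp

/-- The commutator of `E` and `F` is a multiple of `K - K̄`, hence lies in the ideal `W`; the
Leibniz rule carries this to powers of `E`. -/
theorem F_mul_E_pow_sub_mem (i : ℕ) : F q * E q ^ i - E q ^ i * F q ∈ W q := by
  induction i with
  | zero => simp
  | succ i ih =>
    have h : F q * E q ^ (i + 1) - E q ^ (i + 1) * F q =
        (F q * E q ^ i - E q ^ i * F q) * E q - E q ^ i * (E q * F q - F q * E q) := by
      rw [pow_succ]
      noncomm_ring
    rw [h, EF]
    exact sub_mem (mem_W_mul _ ih)
      (mul_mem_W _ ((W q).smul_mem _ (sub_mem K_mem_W Kb_mem_W)))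

/-- The sum contains `1`, so it is enough that left multiplication by each generator preserves it.
`E` raises an exponent, `F` does so modulo `W`, and `K`, `K̄` send everything into `W`. -/
theorem spanEF_sup_W : spanEF q ⊔ W q = ⊤ := by
  -- As `W` is a left ideal, stability under `g` needs checking only on the monomials.
  have key : ∀ g : WSl q, (∀ i j : ℕ, g * (E q ^ i * F q ^ j) ∈ spanEF q ⊔ W q) →
      ∀ x ∈ spanEF q ⊔ W q, g * x ∈ spanEF q ⊔ W q := by
    intro g hg x hx
    have hle : spanEF q ⊔ W q ≤ (spanEF q ⊔ W q).comap (LinearMap.mulLeft k g) := by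
      refine sup_le (Submodule.span_le.2 ?_) fun w hw =>
        Submodule.mem_sup_right (mul_mem_W g hw)
      rintro _ ⟨i, j, rfl⟩
      exact hg i j
    exact hle hx
  have mono : ∀ i j : ℕ, E q ^ i * F q ^ j ∈ spanEF q := fun i j =>
    Submodule.subset_span ⟨i, j, rfl⟩
  refine eq_top_iff.2 fun a _ => ?_
  refine induction_left (P := fun a => a ∈ spanEF q ⊔ W q)
    (Submodule.mem_sup_left (by simpa using mono 0 0)) (fun _ _ => add_mem)
    (fun c _ => Submodule.smul_mem _ c) (key _ fun i j => ?_) (key _ fun i j => ?_)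
    (key _ fun i j => Submodule.mem_sup_right (mem_W_mul _ K_mem_W))
    (key _ fun i j => Submodule.mem_sup_right (mem_W_mul _ Kb_mem_W)) a
  · rw [← mul_assoc, ← pow_succ']
    exact Submodule.mem_sup_left (mono _ _)
  · have h : F q * (E q ^ i * F q ^ j) =
        E q ^ i * F q ^ (j + 1) + (F q * E q ^ i - E q ^ i * F q) * F q ^ j := by
      rw [pow_succ']
      noncomm_ring
    rw [h]
    exact add_mem (Submodule.mem_sup_left (mono _ _))
      (Submodule.mem_sup_right (mem_W_mul _ (F_mul_E_pow_sub_mem i)))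

/-- Modulo `W` every element is a combination of the `E ^ i * F ^ j`, and `toPoly` is injective on
those combinations. -/
theorem toPoly_eq_zero_iff {a : WSl q} : toPoly q a = 0 ↔ a ∈ W q := by
  refine ⟨fun h => ?_, fun h => W_le_ker_toPoly h⟩
  obtain ⟨s, hs, w, hw, rfl⟩ :=
    Submodule.mem_sup.1 (spanEF_sup_W (q := q) ▸ Submodule.mem_top : a ∈ spanEF q ⊔ W q)
  have hw0 : toPoly q w = 0 := W_le_ker_toPoly hw
  rw [map_add, hw0, add_zero] at h
  rw [← ofPoly_toPoly (fun i j => by simp) hs, h, map_zero, zero_add]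
  exact hw

/-! ### Complements of `W`, and the subalgebra `Y`. -/

/-- Any lift of the monomial basis of the polynomial ring spans a complement of `W`. -/
theorem isCompl_span_W {b : ℕ → ℕ → WSl q} (hb : ∀ i j, toPoly q (b i j) = .X 0 ^ i * .X 1 ^ j) :
    IsCompl (Submodule.span k {x | ∃ i j : ℕ, x = b i j}) (W q) := by
  constructor
  · rw [Submodule.disjoint_def]
    intro x hx hxW
    rw [← ofPoly_toPoly hb hx, toPoly_eq_zero_iff.2 hxW, map_zero]
  · rw [codisjoint_iff, eq_top_iff, ← spanEF_sup_W]
    refine sup_le (Submodule.span_le.2 ?_) le_sup_right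
    rintro _ ⟨i, j, rfl⟩
    -- `E ^ i * F ^ j` and `b i j` have the same image under `toPoly`, so they differ by an element
    -- of its kernel `W`.
    rw [← add_sub_cancel (b i j) (E q ^ i * F q ^ j)]
    exact add_mem (Submodule.mem_sup_left (Submodule.subset_span ⟨i, j, rfl⟩))
      (Submodule.mem_sup_right (toPoly_eq_zero_iff.1 (by simp [hb])))

theorem isCompl_spanEF_W : IsCompl (spanEF q) (W q) := isCompl_span_W fun i j => by simp

theorem isCompl_Y_W : IsCompl (Y q) (W q) := isCompl_span_W fun i j => by simp

/-- The central idempotent `1 - J` annihilates `K - K̄`, hence also the commutator of `E` and `F`.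
Commutativity is what closes `Y` under products. -/
theorem commute_mul_one_sub_J : Commute (E q * (1 - J q)) (F q * (1 - J q)) := by
  have hJ : ∀ a b : WSl q, a * (1 - J q) * (b * (1 - J q)) = a * b * (1 - J q) := fun a b => by
    have h1 : (1 - J q) * b = b * (1 - J q) := by rw [sub_mul, J_comm, mul_sub, one_mul, mul_one]
    have h2 : (1 - J q) * (1 - J q) = 1 - J q := by
      rw [mul_sub, mul_one, sub_mul, J_mul_J, one_mul, sub_self, sub_zero]
    rw [mul_assoc, ← mul_assoc (1 - J q), h1, mul_assoc b, h2, mul_assoc]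
  rw [Commute, SemiconjBy, hJ, hJ, ← sub_eq_zero, ← sub_mul, EF, smul_mul_assoc, mul_sub, mul_one,
    sub_mul, K_mul_J, Kb_mul_J, sub_self, smul_zero]

theorem Y_mul_mem {x y : WSl q} (hx : x ∈ Y q) (hy : y ∈ Y q) : x * y ∈ Y q := by
  have h : Y q * Y q ≤ Y q := by
    rw [Y, Submodule.span_mul_span]
    refine Submodule.span_mono ?_
    rintro _ ⟨_, ⟨i, j, rfl⟩, _, ⟨i', j', rfl⟩, rfl⟩
    refine ⟨i + i', j + j', ?_⟩
    have hc := ((commute_mul_one_sub_J (q := q)).pow_pow i' j).eq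
    beta_reduce
    rw [pow_add, pow_add, mul_assoc, ← mul_assoc (_ ^ j), ← hc]
    simp only [mul_assoc]
  exact h (Submodule.mul_mem_mul hx hy)

theorem one_mem_Y : (1 : WSl q) ∈ Y q := Submodule.subset_span ⟨0, 0, by simp⟩

/-! ### The structure maps of `W` are restrictions. -/

/-- Projecting both tensor factors amounts to multiplying by `J ⊗ J`. As `J` is group-like and `w =
J w`, this leaves the coproduct of `w` unchanged. -/
theorem map_subtype_comul (w : W q) :
    TensorProduct.map (W q).subtype (W q).subtype (Coalgebra.comul (R := k) w) =
      Coalgebra.comul (R := k) (w : WSl q) := by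
  have key : ∀ t : WSl q ⊗[k] WSl q, TensorProduct.map (W q).subtype (W q).subtype
      (Algebra.TensorProduct.map (proj q) (proj q) t) = (J q ⊗ₜ[k] J q) * t := by
    intro t
    induction t with
    | zero => simp
    | add x y hx hy => rw [map_add, map_add, hx, hy, mul_add]
    | tmul x y => simp [coe_proj]
  have hJ : comulHom q (J q) = J q ⊗ₜ[k] J q := by simp [J]
  change TensorProduct.map _ _ (Algebra.TensorProduct.map (proj q) (proj q) (comulHom q w)) =
    comulHom q w
  rw [key, ← hJ, ← map_mul, W_J_mul w.2]

/-- The weak antipode fixes `J`, so the image of `w = J w` is already a multiple of `J` and the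
projection does nothing to it. -/
theorem coe_antipode (w : W q) :
    ((HopfAlgebra.antipode k w : W q) : WSl q) = weakAntipode q (w : WSl q) := by
  change J q * weakAntipode q w = _
  rw [J_comm, ← weakAntipode_J, ← weakAntipode_mul, W_J_mul w.2]

end WSl

/-! ### The isomorphism between `U_q` and `W`. -/

namespace USl

variable {k : Type*} [Field k] (q : kˣ)

/-- The algebra morphism from `U_q` to `W`. -/
def toW : USl q →ₐ[k] WSl.W q :=
  lift (WSl.proj q (WSl.E q)) (WSl.proj q (WSl.F q)) (WSl.proj q (WSl.K q))
    (WSl.proj q (WSl.Kb q)) WSl.proj_inv' WSl.proj_inv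
    (conj_eq WSl.proj_inv (by rw [← map_mul, ← map_mul, ← map_smul, WSl.KE]))
    (conj_eq WSl.proj_inv (by rw [← map_mul, ← map_mul, ← map_smul, WSl.KF]))
    (by rw [← map_mul, ← map_mul, ← map_sub, ← map_sub, ← map_smul, WSl.EF])

/-- The algebra morphism from `wsl_q(2)` to `U_q` that makes the weak inverse an inverse. -/
def ofWSl : WSl q →ₐ[k] USl q :=
  WSl.lift (E q) (F q) (K q) (Ki q) (inv'.trans inv.symm) (by rw [inv', one_mul])
    (by rw [inv, one_mul]) KE KiE KF KiF EF

variable {q}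

@[simp] theorem toW_E : toW q (E q) = WSl.proj q (WSl.E q) := lift_E
@[simp] theorem toW_F : toW q (F q) = WSl.proj q (WSl.F q) := lift_F
@[simp] theorem toW_K : toW q (K q) = WSl.proj q (WSl.K q) := lift_K
@[simp] theorem toW_Ki : toW q (Ki q) = WSl.proj q (WSl.Kb q) := lift_Ki

@[simp] theorem ofWSl_E : ofWSl q (WSl.E q) = E q := WSl.lift_E
@[simp] theorem ofWSl_F : ofWSl q (WSl.F q) = F q := WSl.lift_F
@[simp] theorem ofWSl_K : ofWSl q (WSl.K q) = K q := WSl.lift_K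
@[simp] theorem ofWSl_Kb : ofWSl q (WSl.Kb q) = Ki q := WSl.lift_Kb

@[simp] theorem ofWSl_J : ofWSl q (WSl.J q) = 1 := by simp [WSl.J, inv']

theorem toW_ofWSl (a : WSl q) : toW q (ofWSl q a) = WSl.proj q a := by
  have h : (toW q).comp (ofWSl q) = WSl.proj q := by apply WSl.hom_ext <;> simp
  exact DFunLike.congr_fun h a

theorem ofWSl_proj (a : WSl q) : ofWSl q (WSl.proj q a) = ofWSl q a := by
  rw [WSl.coe_proj, map_mul, ofWSl_J, one_mul]

/-- The restriction of `ofWSl` to `W` is unital because `J` goes to `1`. It is not bundled as an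
algebra morphism, so induction on `u` takes the place of `hom_ext`. -/
theorem ofWSl_toW (u : USl q) : ofWSl q (toW q u) = u := by
  induction u using induction with
  | one => rw [map_one, WSl.coe_one, ofWSl_J]
  | add x y hx hy => rw [map_add, Submodule.coe_add, map_add, hx, hy]
  | smul c x hx => rw [map_smul, Submodule.coe_smul, map_smul, hx]
  | mul x y hx hy => rw [map_mul, WSl.coe_mul, map_mul, hx, hy]
  | hE => rw [toW_E, ofWSl_proj, ofWSl_E]
  | hF => rw [toW_F, ofWSl_proj, ofWSl_F]
  | hK => rw [toW_K, ofWSl_proj, ofWSl_K]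
  | hKi => rw [toW_Ki, ofWSl_proj, ofWSl_Kb]

theorem toW_bijective : Function.Bijective (toW q) :=
  ⟨Function.LeftInverse.injective (g := fun w : WSl.W q => ofWSl q w) ofWSl_toW,
    -- Surjectivity: `toW ∘ ofWSl` is multiplication by `J`, the identity on `W`.
    fun w => ⟨ofWSl q w, by rw [toW_ofWSl, WSl.proj_coe]⟩⟩

variable (q) in
/-- The bialgebra morphism from `U_q` to `W`. -/
def toWBialgHom : USl q →ₐc[k] WSl.W q :=
  BialgHom.ofAlgHom (toW q)
    (by
      change (WSl.counitW q).comp (toW q) = counitHom q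
      apply hom_ext <;> simp)
    (by
      change (Algebra.TensorProduct.map (toW q) (toW q)).comp (comulHom q) =
        (WSl.comulW q).comp (toW q)
      apply hom_ext <;> simp)

/-- Both sides are anti-multiplicative in `u`, so agreement on the generators propagates to
products. -/
theorem toW_antipode (u : USl q) :
    toW q (HopfAlgebra.antipode k u) = HopfAlgebra.antipode k (toW q u) := by
  change toW q (antipodeMap q u) = WSl.antipodeW q (toW q u)
  induction u using induction with
  | one => simp [antipodeMap_apply]
  | add x y hx hy => simp only [map_add, hx, hy]
  | smul c x hx => simp only [map_smul, hx]
  | mul x y hx hy => rw [antipodeMap_mul, map_mul, map_mul, WSl.antipodeW_mul, hx, hy]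
  | hE | hF | hK | hKi => simp [antipodeMap_apply, WSl.weakAntipode_apply]

end USl

end WeakQuantum

end

theorem theorem14 {k : Type*} [Field k] (q : kˣ) (hq1 : q ≠ 1) (hq2 : q ≠ -1) :
    -- `W` is a two-sided ideal
    (∀ a w : WeakQuantum.WSl q, w ∈ WeakQuantum.WSl.W q →
      a * w ∈ WeakQuantum.WSl.W q ∧ w * a ∈ WeakQuantum.WSl.W q) ∧
    -- the span of the `E^i F^j` is a linear complement of `W`
    IsCompl (WeakQuantum.WSl.spanEF q) (WeakQuantum.WSl.W q) ∧
    -- `Y` is a subalgebra and a linear complement of `W`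
    (∃ A : Subalgebra k (WeakQuantum.WSl q),
      Subalgebra.toSubmodule A = WeakQuantum.WSl.Y q) ∧
    IsCompl (WeakQuantum.WSl.Y q) (WeakQuantum.WSl.W q) ∧
    -- `W` carries the multiplication of `wsl_q(2)`, with unit `J`
    ((1 : WeakQuantum.WSl.W q) : WeakQuantum.WSl q) = WeakQuantum.WSl.J q ∧
    (∀ x y : WeakQuantum.WSl.W q, ((x * y : WeakQuantum.WSl.W q) : WeakQuantum.WSl q) =
      (x : WeakQuantum.WSl q) * (y : WeakQuantum.WSl q)) ∧
    -- the structure maps of the Hopf algebra `W` are the restrictions of those of `wsl_q(2)`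
    (∀ w : WeakQuantum.WSl.W q,
      TensorProduct.map (WeakQuantum.WSl.W q).subtype (WeakQuantum.WSl.W q).subtype
          (Coalgebra.comul (R := k) w) =
        Coalgebra.comul (R := k) (w : WeakQuantum.WSl q) ∧
      Coalgebra.counit (R := k) w = Coalgebra.counit (R := k) (w : WeakQuantum.WSl q) ∧
      ((HopfAlgebra.antipode k w : WeakQuantum.WSl.W q) : WeakQuantum.WSl q) =
        WeakQuantum.WSl.weakAntipode q (w : WeakQuantum.WSl q)) ∧
    -- an isomorphism of Hopf algebras from `U_q(sl_2)` onto `W`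
    ∃ ρ : WeakQuantum.USl q ≃ₐc[k] WeakQuantum.WSl.W q,
      (ρ (WeakQuantum.USl.E q) : WeakQuantum.WSl q) =
        WeakQuantum.WSl.E q * WeakQuantum.WSl.J q ∧
      (ρ (WeakQuantum.USl.F q) : WeakQuantum.WSl q) =
        WeakQuantum.WSl.F q * WeakQuantum.WSl.J q ∧
      (ρ (WeakQuantum.USl.K q) : WeakQuantum.WSl q) = WeakQuantum.WSl.K q ∧
      (ρ (WeakQuantum.USl.Ki q) : WeakQuantum.WSl q) = WeakQuantum.WSl.Kb q ∧
      ∀ u : WeakQuantum.USl q,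
        ρ (HopfAlgebra.antipode k u) = HopfAlgebra.antipode k (ρ u) := by
  refine ⟨fun a w hw => ⟨WeakQuantum.WSl.mul_mem_W a hw, WeakQuantum.WSl.mem_W_mul a hw⟩,
    WeakQuantum.WSl.isCompl_spanEF_W,
    ⟨(WeakQuantum.WSl.Y q).toSubalgebra WeakQuantum.WSl.one_mem_Y
      fun _ _ => WeakQuantum.WSl.Y_mul_mem, rfl⟩,
    WeakQuantum.WSl.isCompl_Y_W, rfl, fun _ _ => rfl,
    fun w => ⟨WeakQuantum.WSl.map_subtype_comul w, rfl, WeakQuantum.WSl.coe_antipode w⟩,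
    BialgEquiv.ofBijective (WeakQuantum.USl.toWBialgHom q) WeakQuantum.USl.toW_bijective,
    ?_, ?_, ?_, ?_, WeakQuantum.USl.toW_antipode⟩
  -- The projection puts `J` on the left; centrality moves it to the right of `E` and `F`, while `K`
  -- and `K̄` absorb it.
  · exact (congrArg Subtype.val WeakQuantum.USl.toW_E).trans (WeakQuantum.WSl.J_comm _)
  · exact (congrArg Subtype.val WeakQuantum.USl.toW_F).trans (WeakQuantum.WSl.J_comm _)
  · exact (congrArg Subtype.val WeakQuantum.USl.toW_K).trans WeakQuantum.WSl.J_mul_K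
  · exact (congrArg Subtype.val WeakQuantum.USl.toW_Ki).trans WeakQuantum.WSl.J_mul_Kb
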